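/- Let $p$ be a prime and let $G$ be a finite group with a split $BN$-pair $(B,N)$ of characteristic $p$ (for example, a finite group of Lie type defined in characteristic $p$): $(B,N)$ is a $BN$-pair, $T=B\cap N$ is an abelian group of order prime to $p$, $B=UT$ where $U=O_p(B)$ is the largest normal $p$-subgroup of $B$, and $\bigcap_{n\in N} nBn^{-1}=T$. Let $k$ be an algebraically closed field of characteristic $r>0$ with $r\neq p$. For a $kT$-module $X$ let $R_T^G(X)=\mathrm{Ind}_B^G(\tilde X)$, where $\tilde X$ is the inflation of $X$ along the projection $B\to T$ with kernel $U$. More generally, for a parabolic subgroup $P$ (an $N$-conjugate of a standard parabolic subgroup) with largest normal $p$-subgroup $U_P$ and Levi complement $L$ (an $N$-conjugate of a standard Levi subgroup, with $P=U_P\rtimes L$), let ${}^*R_L^G(Y)=Y^{U_P}$, a $kL$-module, for every $kG$-module $Y$; in particular ${}^*R_T^G(Y)=Y^U$. For an irreducible $kT$-module $X$, the principal series $\mathrm{Irr}_k(G|(T,X))$ is the set of (isomorphism classes of) irreducible $kG$-modules $Y$ such that $T$ is minimal among the Levi subgroups $L$ with ${}^*R_L^G(Y)\neq 0$ and $X$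 is a composition factor of the $kT$-module ${}^*R_T^G(Y)$. Let $X$ and $X'$ be irreducible $kT$-modules, let $Y\in \mathrm{Irr}_k(G|(T,X))$ and $V\in \mathrm{Irr}_k(G|(T,X'))$, and suppose that $\mathrm{Irr}_k(G|(T,X))\neq \mathrm{Irr}_k(G|(T,X'))$. Then $[R_T^G(X):V]=0$, i.e. $V$ does not occur as a composition factor of $R_T^G(X)$. -/

import Mathlib

open scoped Pointwise MonoidAlgebra

universe w u v

namespace HarishChandra

/-- The largest normal `p`-subgroup `O_p(G)` of a group. -/
def pCore (p : ℕ) (G : Type*) [Group G] : Subgroup G :=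
  sSup {H : Subgroup G | H.Normal ∧ IsPGroup p H}

instance pCore_normal (p : ℕ) (G : Type*) [Group G] : (pCore p G).Normal :=
  Subgroup.sSup_normal _ fun _ h => h.1

theorem pCore_isPGroup (p : ℕ) [Fact p.Prime] (G : Type*) [Group G] [Finite G] :
    IsPGroup p (pCore p G) := by
  obtain ⟨P⟩ : Nonempty (Sylow p G) := inferInstance
  refine P.isPGroup'.to_le (sSup_le ?_)
  rintro H ⟨hn, hp⟩
  have h : IsPGroup p (H ⊔ (P : Subgroup G) : Subgroup G) :=
    hp.to_sup_of_normal_left P.isPGroup'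
  exact le_sup_left.trans (P.is_maximal' h le_sup_right).le

/-- A `BN`-pair `(B, N)` in a group `G`, with `T = B ∩ N`, `W = N / T` and `S` the
distinguished set of involutions generating `W`. -/
structure BNPair (G : Type*) [Group G] where
  /-- The Borel subgroup. -/
  B : Subgroup G
  N : Subgroup G
  /-- `G` is generated by `B` and `N`. -/
  generate : B ⊔ N = ⊤
  /-- `T = B ∩ N` is normal in `N`. -/
  [normal : ((B ⊓ N).subgroupOf N).Normal]
  /-- The distinguished generators of `W = N / T`. -/
  S : Set (N ⧸ (B ⊓ N).subgroupOf N)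
  closure_S : Subgroup.closure S = ⊤
  sq_eq_one : ∀ s ∈ S, s * s = 1
  conj_ne : ∀ n : N, (n : N ⧸ (B ⊓ N).subgroupOf N) ∈ S → MulAut.conj (n : G) • B ≠ B
  /-- `nBm ⊆ BnmB ∪ BmB` for `n` representing an element of `S` and `m ∈ N`. -/
  exchange : ∀ n m : N, (n : N ⧸ (B ⊓ N).subgroupOf N) ∈ S → ∀ b ∈ B,
    (n : G) * b * m ∈
      DoubleCoset.doubleCoset ((n : G) * m) B B ∪ DoubleCoset.doubleCoset (m : G) B B

attribute [instance] BNPair.normal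

/-- A split `BN`-pair of characteristic `p`: `B = UT` with `U = O_p(B)` and `T = B ∩ N` an
abelian `p'`-group, and the intersection of all the `N`-conjugates of `B` is `T`. -/
structure SplitBNPair (p : ℕ) (G : Type*) [Group G] extends BNPair G where
  split : (pCore p B).map B.subtype ⊔ (B ⊓ N) = B
  comm : ∀ s ∈ B ⊓ N, ∀ t ∈ B ⊓ N, s * t = t * s
  coprime : (Nat.card (B ⊓ N : Subgroup G)).Coprime p
  iInf_conj : ⨅ n : N, MulAut.conj (n : G) • B = B ⊓ N

namespace BNPair

variable {G : Type*} [Group G] (D : BNPair G)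

/-- The torus `T = B ∩ N`. -/
abbrev T : Subgroup G := D.B ⊓ D.N

/-- The Weyl group `W = N / T`. -/
abbrev W : Type _ := D.N ⧸ D.T.subgroupOf D.N

/-- The preimage `N_J` in `N` of the parabolic subgroup `W_J = ⟨J⟩` of `W`. -/
def NJ (J : Set D.W) : Subgroup G :=
  ((Subgroup.closure J).comap (QuotientGroup.mk' (D.T.subgroupOf D.N))).map D.N.subtype

/-- The standard parabolic subgroup `P_J = B N_J B`, the subgroup generated by `B` and `N_J`. -/
def standardParabolic (J : Set D.W) : Subgroup G := D.B ⊔ D.NJ J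

/-- `L` is the standard Levi subgroup `L_J`: the intersection of `P_J` with the opposite parabolic
subgroup, generated by `N_J` and the opposite Borel subgroup. The latter is the conjugate of `B` by
the longest element of `W`, that is, the `N`-conjugate of `B` meeting `B` exactly in `T`. -/
def IsStandardLevi (J : Set D.W) (L : Subgroup G) : Prop :=
  ∃ n ∈ D.N, D.B ⊓ MulAut.conj n • D.B = D.T ∧
    L = D.standardParabolic J ⊓ (MulAut.conj n • D.B ⊔ D.NJ J)

/-- Membership in `𝒫_G`, the set of `N`-conjugates of standard parabolic subgroups. -/
def IsParabolic (P : Subgroup G) : Prop :=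
  ∃ J ⊆ D.S, ∃ n ∈ D.N, P = MulAut.conj n • D.standardParabolic J

/-- Membership in `ℒ_G`, the set of `N`-conjugates of standard Levi subgroups. -/
def IsLevi (L : Subgroup G) : Prop :=
  ∃ J ⊆ D.S, ∃ L₀, D.IsStandardLevi J L₀ ∧ ∃ n ∈ D.N, L = MulAut.conj n • L₀

end BNPair

/-- `L` is a Levi complement in `P`, i.e. `P = U_P ⋊ L` with `U_P = O_p(P)`. -/
structure IsLeviComplement (p : ℕ) {G : Type*} [Group G] (P L : Subgroup G) : Prop where
  le : L ≤ P
  compl : (L.subgroupOf P).IsComplement' (pCore p P)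

/-- The projection `P → L` with kernel `U_P`. -/
noncomputable def leviProj {p : ℕ} {G : Type*} [Group G] {P L : Subgroup G}
    (h : IsLeviComplement p P L) : P →* L :=
  (Subgroup.subgroupOfEquivOfLe h.le).toMonoidHom.comp
    (h.compl.QuotientMulEquiv.toMonoidHom.comp (QuotientGroup.mk' (pCore p P)))

/-- The torus `T` is a Levi complement in `B`. -/
theorem SplitBNPair.isLeviComplement {p : ℕ} [Fact p.Prime] {G : Type*} [Group G] [Finite G]
    (D : SplitBNPair p G) : IsLeviComplement p D.B D.T := by
  refine ⟨inf_le_left, Subgroup.isComplement'_of_disjoint_and_mul_eq_univ ?_ ?_⟩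
  · refine Subgroup.disjoint_of_coprime_natCard ?_
    obtain ⟨n, hn⟩ := IsPGroup.iff_card.1 (pCore_isPGroup p D.B)
    rw [hn, Nat.card_congr (Subgroup.subgroupOfEquivOfLe (inf_le_left : D.T ≤ D.B)).toEquiv]
    exact D.coprime.pow_right n
  · rw [← Subgroup.mul_normal]
    have h : D.T.subgroupOf D.B ⊔ pCore p D.B = ⊤ := by
      apply Subgroup.map_injective D.B.subtype_injective
      rw [Subgroup.map_sup, Subgroup.subgroupOf_map_subtype, ← MonoidHom.range_eq_map,
        Subgroup.range_subtype, sup_comm, inf_eq_left.2 (inf_le_left : D.T ≤ D.B)]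
      exact D.split
    rw [h]; rfl

section Modules

variable {k : Type u} [Field k] {G : Type v} [Group G]

/-- The Harish-Chandra induction `R_{L ⊆ P}^G(X)`: inflate `X` from `L` to `P`, then induce
to `G`. -/
noncomputable def hcInd {p : ℕ} {P L : Subgroup G} (h : IsLeviComplement p P L)
    {X : Type*} [AddCommGroup X] [Module k X] (τ : Representation k L X) :
    Representation k G (Representation.IndV P.subtype (τ.comp (leviProj h))) :=
  Representation.ind P.subtype (τ.comp (leviProj h))

/-- The Harish-Chandra restriction `*R_{L ⊆ P}^G(Y)`: the space `Y^{U_P}` with the action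
of `L`. -/
noncomputable def hcRes {p : ℕ} {P L : Subgroup G} (h : IsLeviComplement p P L)
    {Y : Type*} [AddCommGroup Y] [Module k Y] (ρ : Representation k G Y) :
    Representation k L
      (Representation.invariants
        ((ρ.comp P.subtype : Representation k P Y).comp (pCore p P).subtype)) :=
  (Representation.toInvariants (ρ.comp P.subtype : Representation k P Y) (pCore p P)).comp
    (Subgroup.inclusion h.le)

/-- The multiplicity `[M : V]` of `V` as a composition factor of `M`: the number of factors
isomorphic to `V` in a composition series of `M` (by Jordan-Hölder, all of them give the same
number, so that the supremum over all composition series is that number). -/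
noncomputable def compositionMultiplicity {M V : Type*} [AddCommGroup M] [Module k M]
    [AddCommGroup V] [Module k V] (ρ : Representation k G M) (σ : Representation k G V) : ℕ∞ :=
  ⨆ s : {s : CompositionSeries (Submodule k[G] ρ.asModule) // s.head = ⊥ ∧ s.last = ⊤},
    Set.encard {i : Fin s.1.length | Nonempty
      ((s.1 i.succ ⧸ (s.1 i.castSucc).comap (s.1 i.succ).subtype) ≃ₗ[k[G]] σ.asModule)}

/-- The Harish-Chandra series `Irr_k(G|(L,X))`: the irreducible `kG`-modules `Y` such that `L` is
minimal in `ℒ_G` with `*R_L^G(Y) ≠ 0` and `X` is a composition factor of `*R_L^G(Y)`, where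
`*R_L^G` is computed in the parabolic subgroup `P` with Levi complement `L`. It is used for an
irreducible cuspidal `kL`-module `X`, and it is represented as an isomorphism-closed collection of
modules. -/
def hcSeries (D : BNPair G) {p : ℕ} {P L : Subgroup G} (h : IsLeviComplement p P L)
    {X : Type*} [AddCommGroup X] [Module k X] (τ : Representation k L X) : Set (Rep.{w} k G) :=
  {Y | Y.ρ.IsIrreducible ∧
    Nontrivial (Representation.invariants
      ((Y.ρ.comp P.subtype : Representation k P Y.V).comp (pCore p P).subtype)) ∧
    (∀ P' L' : Subgroup G, D.IsParabolic P' → D.IsLevi L' → IsLeviComplement p P' L' → L' < L →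
      Subsingleton (Representation.invariants
        ((Y.ρ.comp P'.subtype : Representation k P' Y.V).comp (pCore p P').subtype))) ∧
    compositionMultiplicity (hcRes h Y.ρ) τ ≠ 0}

/-- The principal series `Irr_k(G|(T,X))`. Every `kT`-module is cuspidal. -/
noncomputable def principalSeries {p : ℕ} [Fact p.Prime] [Finite G] (D : SplitBNPair p G)
    {X : Type*} [AddCommGroup X] [Module k X] (τ : Representation k D.T X) : Set (Rep.{w} k G) :=
  hcSeries D.toBNPair D.isLeviComplement τ

end Modules

end HarishChandra

/-! Since `T` is abelian and `k` is algebraically closed, `X` and `X'` are given by characters `χ`,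
`χ'` of `T`. Call a character a weight of `Y` if `T` acts by it on some nonzero vector of `Y^U`. The
order of `T` may be divisible by `r`, so `kT` need not be semisimple; but it is commutative
Artinian, so each composition factor of `Y^U` also embeds in it. Hence `X` is a composition factor
of `Y^U` exactly when `χ` is a weight of `Y` (`compositionMultiplicity_hcRes_ne_zero_iff`).

Two facts about weights carry the proof, both resting on `p ≠ 0` in `k`. The weights of any
`kG`-module are stable under `N` (`HasWeight.conj`, reduced to simple reflections). By the Bruhat
decomposition, the `U`-invariants of `R_T^G(X)` are spanned by `T`-eigenvectors with characters
conjugate to `χ` (`range_sumU_hcInd_le`), and a subquotient acquires no other weights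
(`exists_eq_of_hasWeight_subquotient`).

So if `V` occurs in `R_T^G(X)`, its weight `χ'` is an `N`-conjugate of `χ`. Then `χ` and `χ'` are
weights of the same irreducible modules, and the two series coincide. -/

namespace HarishChandra

/-! ### Composition factors over finite commutative groups -/

section CompositionFactors

/-- A simple subquotient of a finitely generated module over a commutative Artinian ring embeds
into the module. -/
theorem exists_linearMap_ne_zero_of_subquotient {A : Type*} [CommRing A] [IsArtinianRing A]
    {M X : Type*} [AddCommGroup M] [Module A M] [Module.Finite A M] [AddCommGroup X] [Module A X]
    [IsSimpleModule A X] {N₁ N₂ : Submodule A M}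
    (e : (N₂ ⧸ N₁.comap N₂.subtype) ≃ₗ[A] X) : ∃ f : X →ₗ[A] M, f ≠ 0 := by
  have := IsSimpleModule.nontrivial A X
  obtain ⟨x, hx⟩ := exists_ne (0 : X)
  let I : Ideal A := LinearMap.ker (LinearMap.toSpanSingleton A X x)
  have hI : I.IsMaximal := IsSimpleModule.ker_toSpanSingleton_isMaximal A hx
  have hle : Module.annihilator A M ≤ I := by
    intro a ha
    obtain ⟨v, hv⟩ := Submodule.mkQ_surjective _ (e.symm x)
    have : a • e.symm x = 0 := by
      rw [← hv, ← map_smul]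
      have : a • v = 0 := Subtype.ext (Module.mem_annihilator.1 ha v)
      rw [this, map_zero]
    rw [← map_smul, LinearEquiv.map_eq_zero_iff] at this
    simpa [I] using this
  -- In an Artinian ring every prime is maximal, so `I` is minimal over the annihilator of `M`. Such
  -- primes are associated: `I` is the annihilator of some `w` in `M`, and `A w` is a copy of `X`.
  have hmin : I ∈ (Module.annihilator A M).minimalPrimes := by
    refine ⟨⟨hI.isPrime, hle⟩, fun J hJ hJI => ?_⟩
    have := hJ.1
    have hJm : J.IsMaximal := inferInstance
    exact (hJm.eq_of_le hI.ne_top hJI).ge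
  obtain ⟨-, w, hw⟩ := Submodule.isAssociatedPrime_iff.1
    (Module.associatedPrimes.minimalPrimes_annihilator_subset_associatedPrimes A M hmin)
  have hw' : I = LinearMap.ker (LinearMap.toSpanSingleton A M w) := by
    rw [hw]
    ext a
    simp [Submodule.mem_colon_singleton]
  let f : X →ₗ[A] M := (I.liftQ (LinearMap.toSpanSingleton A M w) hw'.le).comp
    ((LinearMap.toSpanSingleton A X x).quotKerEquivOfSurjective
      (IsSimpleModule.toSpanSingleton_surjective A hx)).symm.toLinearMap
  refine ⟨f, fun hf => hI.ne_top ?_⟩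
  have hfx : f x = w := by
    have : ((LinearMap.toSpanSingleton A X x).quotKerEquivOfSurjective
      (IsSimpleModule.toSpanSingleton_surjective A hx)).symm x = Submodule.Quotient.mk 1 := by
      rw [LinearEquiv.symm_apply_eq]
      exact (one_smul A x).symm
    simp only [f, LinearMap.comp_apply, LinearEquiv.coe_coe, this]
    exact one_smul A w
  rw [hw', ← hfx, hf]
  ext a
  simp

/-- A simple submodule of a module with a composition series occurs among the factors. -/
theorem exists_factor_equiv_of_linearMap_ne_zero {A : Type*} [Ring A]
    {M X : Type*} [AddCommGroup M] [Module A M] [AddCommGroup X] [Module A X]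
    [IsSimpleModule A X] {f : X →ₗ[A] M} (hf : f ≠ 0)
    (s : CompositionSeries (Submodule A M)) (hs : s.head = ⊥) (hs' : s.last = ⊤) :
    ∃ i : Fin s.length,
      Nonempty ((s i.succ ⧸ (s i.castSucc).comap (s i.succ).subtype) ≃ₗ[A] X) := by
  -- At a step where the image of `f` enters the chain, the induced map from `X` to that factor is
  -- nonzero, hence an isomorphism of simple modules.
  obtain ⟨i, hi, hi'⟩ : ∃ i : Fin s.length,
      ¬ LinearMap.range f ≤ s i.castSucc ∧ LinearMap.range f ≤ s i.succ := by
    by_contra! h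
    have : ∀ i, ¬ LinearMap.range f ≤ s i := by
      intro i
      induction i using Fin.induction with
      | zero =>
        change ¬ LinearMap.range f ≤ s.head
        rwa [hs, le_bot_iff, LinearMap.range_eq_bot]
      | succ i ih => exact h i ih
    refine this (Fin.last _) ?_
    change _ ≤ s.last
    rw [hs']
    exact le_top
  refine ⟨i, ⟨LinearEquiv.symm (LinearEquiv.ofBijective
    (((s i.castSucc).comap (s i.succ).subtype).mkQ.comp
      (f.codRestrict (s i.succ) fun x => hi' ⟨x, rfl⟩)) ?_)⟩⟩
  have := (covBy_iff_quot_is_simple (s.step i).le).1 (s.step i)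
  refine LinearMap.bijective_of_ne_zero fun h0 => hi ?_
  rintro _ ⟨x, rfl⟩
  have := LinearMap.congr_fun h0 x
  simpa using this

variable {k : Type*} [Field k] {H : Type*} [Group H]
  {M V : Type*} [AddCommGroup M] [Module k M] [AddCommGroup V] [Module k V]

theorem compositionMultiplicity_ne_zero_iff (ρ : Representation k H M)
    (σ : Representation k H V) : compositionMultiplicity ρ σ ≠ 0 ↔
      ∃ s : CompositionSeries (Submodule k[H] ρ.asModule), s.head = ⊥ ∧ s.last = ⊤ ∧
        ∃ i : Fin s.length, Nonempty
          ((s i.succ ⧸ (s i.castSucc).comap (s i.succ).subtype) ≃ₗ[k[H]] σ.asModule) := by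
  rw [compositionMultiplicity, ← bot_eq_zero, ne_eq, iSup_eq_bot]
  push Not
  simp only [bot_eq_zero, ne_eq, Set.encard_eq_zero, ← Set.nonempty_iff_ne_empty]
  constructor
  · rintro ⟨⟨s, h⟩, i, hi⟩
    exact ⟨s, h.1, h.2, i, hi⟩
  · rintro ⟨s, h, h', i, hi⟩
    exact ⟨⟨s, h, h'⟩, i, hi⟩

theorem _root_.Representation.IsIrreducible.finiteDimensional [Finite H]
    {ρ : Representation k H M} (h : ρ.IsIrreducible) : FiniteDimensional k M := by
  have : IsSimpleModule k[H] ρ.asModule :=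
    (Representation.irreducible_iff_isSimpleModule_asModule ρ).1 h
  have : Module.Finite k[H] ρ.asModule := inferInstance
  have : Module.Finite k ρ.asModule := Module.Finite.trans k[H] ρ.asModule
  exact Module.Finite.equiv ρ.asModuleEquiv

-- Commutativity is what replaces semisimplicity: over `k[H]` a simple subquotient is also a
-- submodule, even when the characteristic divides the order of `H`.
open scoped IsMulCommutative in
theorem compositionMultiplicity_ne_zero_iff_exists_intertwiningMap [Finite H] [IsMulCommutative H]
    [FiniteDimensional k M] (ρ : Representation k H M) {σ : Representation k H V}
    (hσ : σ.IsIrreducible) :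
    compositionMultiplicity ρ σ ≠ 0 ↔ ∃ f : Representation.IntertwiningMap σ ρ, f ≠ 0 := by
  have : IsSimpleModule k[H] σ.asModule :=
    (Representation.irreducible_iff_isSimpleModule_asModule σ).1 hσ
  have : IsArtinianRing k[H] := IsArtinianRing.of_finite k k[H]
  have : Module.Finite k[H] ρ.asModule := Module.Finite.of_restrictScalars_finite k _ _
  have key : (∃ f : Representation.IntertwiningMap σ ρ, f ≠ 0) ↔
      ∃ f : σ.asModule →ₗ[k[H]] ρ.asModule, f ≠ 0 := by
    constructor
    · rintro ⟨f, hf⟩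
      exact ⟨Representation.IntertwiningMap.equivLinearMapAsModule σ ρ f, by simpa using hf⟩
    · rintro ⟨f, hf⟩
      exact ⟨(Representation.IntertwiningMap.equivLinearMapAsModule σ ρ).symm f, by simpa using hf⟩
  rw [compositionMultiplicity_ne_zero_iff, key]
  constructor
  · rintro ⟨s, -, -, i, ⟨e⟩⟩
    exact exists_linearMap_ne_zero_of_subquotient e
  · rintro ⟨f, hf⟩
    obtain ⟨s, hs, hs'⟩ :=
      exists_compositionSeries_of_isNoetherian_isArtinian k[H] ρ.asModule
    exact ⟨s, hs, hs', exists_factor_equiv_of_linearMap_ne_zero hf s hs hs'⟩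

/-- An irreducible representation of a finite commutative group over an algebraically closed field
is one-dimensional, hence given by a character. -/
theorem exists_character [Finite H] [IsMulCommutative H] [IsAlgClosed k]
    {σ : Representation k H V} (hσ : σ.IsIrreducible) :
    ∃ χ : H → k, (∀ h x, σ h x = χ h • x) ∧ Module.finrank k V = 1 := by
  have := hσ.finiteDimensional
  have h1 : Module.finrank k V = 1 :=
    Representation.IsIrreducible.finrank_eq_one_of_isMulCommutative σ
  have : ∀ h, ∃ c : k, ∀ x, σ h x = c • x := by
    intro h
    obtain ⟨v, hv, hv'⟩ := finrank_eq_one_iff'.1 h1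
    obtain ⟨c, hc⟩ := hv' (σ h v)
    refine ⟨c, fun x => ?_⟩
    obtain ⟨d, rfl⟩ := hv' x
    rw [map_smul, ← hc, smul_comm]
  choose χ hχ using this
  exact ⟨χ, hχ, h1⟩

theorem compositionMultiplicity_ne_zero_iff_exists_eigenvector [Finite H] [IsMulCommutative H]
    [FiniteDimensional k M] (ρ : Representation k H M) {σ : Representation k H V}
    (hσ : σ.IsIrreducible) {χ : H → k} (hχ : ∀ h x, σ h x = χ h • x)
    (hV : Module.finrank k V = 1) :
    compositionMultiplicity ρ σ ≠ 0 ↔ ∃ y : M, y ≠ 0 ∧ ∀ h, ρ h y = χ h • y := by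
  rw [compositionMultiplicity_ne_zero_iff_exists_intertwiningMap ρ hσ]
  constructor
  · rintro ⟨f, hf⟩
    obtain ⟨x, hx⟩ : ∃ x, f x ≠ 0 := by
      by_contra! h
      exact hf (by ext x; exact h x)
    exact ⟨f x, hx, fun h => by rw [← f.isIntertwining, hχ, map_smul]⟩
  · rintro ⟨y, hy, hy'⟩
    have := hσ.finiteDimensional
    let e : V ≃ₗ[k] k := LinearEquiv.ofFinrankEq V k (by simp [hV])
    refine ⟨⟨(LinearMap.toSpanSingleton k M y).comp e.toLinearMap, fun h => ?_⟩, fun h0 => hy ?_⟩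
    · ext x
      simp [hχ, hy', mul_smul, smul_comm (χ h)]
    · simpa using congr($h0 (e.symm 1))

end CompositionFactors

end HarishChandra

/-! ### BN-pairs and the Bruhat decomposition -/

namespace HarishChandra

namespace BNPair

variable {G : Type*} [Group G] (D : BNPair G)

theorem conj_mem_T {n t : G} (hn : n ∈ D.N) (ht : t ∈ D.T) : n * t * n⁻¹ ∈ D.T :=
  D.normal.conj_mem ⟨t, ht.2⟩ ht ⟨n, hn⟩

/-- `N` is generated, as a monoid, by `T` and the representatives of the elements of `S`. -/
theorem N_induction {P : G → Prop} (hT : ∀ t ∈ D.T, P t)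
    (hS : ∀ n : D.N, (n : D.W) ∈ D.S → P n)
    (hmul : ∀ a ∈ D.N, ∀ b ∈ D.N, P a → P b → P (a * b)) {n : G} (hn : n ∈ D.N) : P n := by
  suffices ∀ w : D.W, ∀ n : D.N, (n : D.W) = w → P n from this _ ⟨n, hn⟩ rfl
  intro w
  have hw : w ∈ Submonoid.closure D.S := by
    -- The generators are involutions, so words in `S` without inverses already exhaust `W`.
    have hinv : D.S⁻¹ ⊆ D.S := fun s hs => by
      rw [← inv_inv s, ← eq_inv_of_mul_eq_one_left (D.sq_eq_one _ hs)]
      exact hs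
    have := Subgroup.closure_toSubmonoid D.S
    rw [D.closure_S, Set.union_eq_left.2 hinv] at this
    rw [← this]
    trivial
  induction hw using Submonoid.closure_induction with
  | mem s hs => rintro n rfl; exact hS n hs
  | one =>
    intro n hn
    exact hT n ((QuotientGroup.eq_one_iff n).1 hn)
  | mul a b _ _ ha hb =>
    intro n hn
    obtain ⟨m, rfl⟩ := QuotientGroup.mk_surjective a
    have := hmul m m.2 (m⁻¹ * n : D.N) (m⁻¹ * n : D.N).2 (ha m rfl) (hb _ (by simp [hn]))
    simpa using this

/-- The Bruhat decomposition `G = BNB`. -/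
theorem bruhat (g : G) : ∃ b ∈ D.B, ∃ n ∈ D.N, ∃ b' ∈ D.B, g = b * n * b' := by
  let Q : G → Prop := fun g => ∃ b ∈ D.B, ∃ n ∈ D.N, ∃ b' ∈ D.B, g = b * n * b'
  have hB : ∀ a ∈ D.B, ∀ x, Q x → Q (a * x) := by
    rintro a ha _ ⟨b, hb, n, hn, b', hb', rfl⟩
    exact ⟨a * b, mul_mem ha hb, n, hn, b', hb', by group⟩
  have hN : ∀ a ∈ D.N, ∀ x, Q x → Q (a * x) := by
    intro a ha
    refine D.N_induction (P := fun a => ∀ x, Q x → Q (a * x)) (fun t ht => hB t ht.1) ?_ ?_ ha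
    · rintro n hn _ ⟨b, hb, m, hm, b', hb', rfl⟩
      have := D.exchange n ⟨m, hm⟩ hn b hb
      simp only [Set.mem_union, DoubleCoset.mem_doubleCoset] at this
      rcases this with ⟨x, hx, y, hy, h⟩ | ⟨x, hx, y, hy, h⟩
      · exact ⟨x, hx, n * m, mul_mem n.2 hm, y * b', mul_mem hy hb',
          by simp only [← mul_assoc]; rw [h]; group⟩
      · exact ⟨x, hx, m, hm, y * b', mul_mem hy hb',
          by simp only [← mul_assoc]; rw [h]⟩
    · intro a _ b _ h h' x hx
      rw [mul_assoc]
      exact h _ (h' _ hx)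
  have hg : g ∈ Subgroup.closure ((D.B : Set G) ∪ D.N) := by
    rw [← Subgroup.sup_eq_closure, D.generate]
    trivial
  suffices ∀ x, Q x → Q (g * x) by
    simpa using this 1 ⟨1, one_mem _, 1, one_mem _, 1, one_mem _, by simp⟩
  induction hg using Subgroup.closure_induction'' with
  | mem x hx => exact hx.elim (hB x) (hN x)
  | inv_mem x hx => exact hx.elim (fun h => hB _ (inv_mem h)) (fun h => hN _ (inv_mem h))
  | one => simp
  | mul x y _ _ h h' =>
    intro z hz
    rw [mul_assoc]
    exact h _ (h' _ hz)

end BNPair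

/-! ### The decomposition `B = UT` -/

namespace SplitBNPair

variable {p : ℕ} {G : Type*} [Group G] (D : SplitBNPair p G)

/-- The unipotent radical `U = O_p(B)` as a subgroup of `G`. -/
def U : Subgroup G := (pCore p D.B).map D.B.subtype

theorem U_le_B : D.U ≤ D.B := Subgroup.map_subtype_le _

theorem conj_mem_U {b u : G} (hb : b ∈ D.B) (hu : u ∈ D.U) : b * u * b⁻¹ ∈ D.U := by
  obtain ⟨u, hu, rfl⟩ := hu
  exact ⟨⟨b, hb⟩ * u * ⟨b, hb⟩⁻¹, (pCore_normal p D.B).conj_mem u hu _, rfl⟩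

theorem isMulCommutative_T : IsMulCommutative D.T :=
  ⟨⟨fun s t => Subtype.ext (D.comm s s.2 t t.2)⟩⟩

variable [Fact p.Prime] [Finite G]

theorem leviProj_eq_one_iff (b : D.B) : leviProj D.isLeviComplement b = 1 ↔ (b : G) ∈ D.U := by
  simp only [leviProj, U, MonoidHom.comp_apply, MulEquiv.toMonoidHom_eq_coe, MonoidHom.coe_coe,
    EmbeddingLike.map_eq_one_iff, QuotientGroup.mk'_apply, QuotientGroup.eq_one_iff]
  simp

theorem leviProj_of_mem_T (t : D.B) (ht : (t : G) ∈ D.T) :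
    leviProj D.isLeviComplement t = ⟨t, ht⟩ := by
  have h : D.isLeviComplement.compl.QuotientMulEquiv (QuotientGroup.mk' _ t) = ⟨t, ht⟩ :=
    (Equiv.symm_apply_eq _).2 rfl
  simp only [leviProj, MonoidHom.comp_apply, MulEquiv.toMonoidHom_eq_coe, MonoidHom.coe_coe, h]
  rfl

theorem exists_eq_mul {b : G} (hb : b ∈ D.B) : ∃ u ∈ D.U, ∃ t ∈ D.T, b = u * t := by
  let t := leviProj D.isLeviComplement ⟨b, hb⟩
  have ht : (t : G) ∈ D.B := t.2.1
  refine ⟨b * (t : G)⁻¹, ?_, t, t.2, by simp⟩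
  refine (D.leviProj_eq_one_iff (⟨b, hb⟩ * ⟨t, ht⟩⁻¹)).1 ?_
  rw [map_mul, map_inv, D.leviProj_of_mem_T ⟨t, ht⟩ t.2]
  exact mul_inv_cancel t

theorem exists_card_U_eq : ∃ m, Nat.card D.U = p ^ m :=
  IsPGroup.iff_card.1 ((pCore_isPGroup p D.B).map D.B.subtype)

/-- The conjugate has `p`-power order while `T` has order prime to `p`, so its projection to `T` is
trivial. -/
theorem mem_U_of_conj {n u : G} (hu : u ∈ D.U) (h : n * u * n⁻¹ ∈ D.B) : n * u * n⁻¹ ∈ D.U := by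
  refine (D.leviProj_eq_one_iff ⟨_, h⟩).1 ?_
  obtain ⟨m, hm⟩ := D.exists_card_U_eq
  have h1 : (⟨n * u * n⁻¹, h⟩ : D.B) ^ p ^ m = 1 := by
    have : u ^ p ^ m = 1 := by
      have := pow_card_eq_one' (x := (⟨u, hu⟩ : D.U))
      rw [hm] at this
      simpa using congr_arg Subtype.val this
    ext
    simp [conj_pow, this]
  have h2 := congr_arg (leviProj D.isLeviComplement) h1
  rw [map_pow, map_one] at h2
  have h3 := (D.coprime.pow_right m)
  rw [← orderOf_eq_one_iff]
  exact Nat.eq_one_of_dvd_coprimes h3 (orderOf_dvd_natCard _) (orderOf_dvd_of_pow_eq_one h2)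

end SplitBNPair

end HarishChandra

/-! ### Weights and their stability under `N` -/

namespace HarishChandra

namespace SplitBNPair

section Weights

variable {p : ℕ} {k : Type*} [Field k] {G : Type*} [Group G] (D : SplitBNPair p G)
  {M : Type*} [AddCommGroup M] [Module k M] (ρ : Representation k G M)

/-- The `U`-invariants of `ρ` contain a nonzero `T`-eigenvector with eigenvalues `χ`. -/
def HasWeight (χ : G → k) : Prop :=
  ∃ y : M, y ≠ 0 ∧ (∀ u ∈ D.U, ρ u y = y) ∧ ∀ t ∈ D.T, ρ t y = χ t • y

variable {D ρ} in
theorem HasWeight.congr {χ ψ : G → k} (h : D.HasWeight ρ χ) (hχ : ∀ t ∈ D.T, χ t = ψ t) :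
    D.HasWeight ρ ψ := by
  obtain ⟨y, hy, hU, hT⟩ := h
  exact ⟨y, hy, hU, fun t ht => by rw [hT t ht, hχ t ht]⟩

variable [Finite G]

/-- The action of the sum of the elements of `U`. -/
noncomputable def sumU : Module.End k M :=
  letI := Fintype.ofFinite D.U
  Representation.norm (ρ.comp D.U.subtype)

theorem sumU_apply [Fintype D.U] (y : M) : D.sumU ρ y = ∑ u : D.U, ρ u y := by
  simp only [sumU, Representation.norm, LinearMap.sum_apply]
  refine Finset.sum_congr (by ext; simp) fun u _ => rfl

theorem sumU_apply_of_mem {u : G} (hu : u ∈ D.U) (y : M) : D.sumU ρ (ρ u y) = D.sumU ρ y :=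
  letI := Fintype.ofFinite D.U
  Representation.norm_self_apply (ρ.comp D.U.subtype) ⟨u, hu⟩ y

theorem apply_sumU_of_mem {u : G} (hu : u ∈ D.U) (y : M) : ρ u (D.sumU ρ y) = D.sumU ρ y :=
  letI := Fintype.ofFinite D.U
  Representation.self_norm_apply (ρ.comp D.U.subtype) ⟨u, hu⟩ y

theorem sumU_comm {b : G} (hb : b ∈ D.B) (y : M) : D.sumU ρ (ρ b y) = ρ b (D.sumU ρ y) := by
  let := Fintype.ofFinite D.U
  rw [sumU_apply, sumU_apply, map_sum]
  symm
  let c : D.U → D.U := fun u => ⟨b * u * b⁻¹, D.conj_mem_U hb u.2⟩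
  have hc : Function.Injective c := fun u v h => by simpa [c] using h
  refine Fintype.sum_bijective c (Finite.injective_iff_bijective.1 hc) _ _ fun u => ?_
  simp only [← Module.End.mul_apply, ← map_mul]
  simp [c]

theorem sumU_of_invariant {y : M} (hy : ∀ u ∈ D.U, ρ u y = y) :
    D.sumU ρ y = (Nat.card D.U : k) • y := by
  let := Fintype.ofFinite D.U
  rw [sumU_apply, Finset.sum_congr rfl fun (u : D.U) _ => hy u u.2]
  simp [Nat.card_eq_fintype_card, Nat.cast_smul_eq_nsmul]

variable [Fact p.Prime]

theorem card_U_ne_zero (hp : (p : k) ≠ 0) : (Nat.card D.U : k) ≠ 0 := by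
  obtain ⟨m, hm⟩ := D.exists_card_U_eq
  rw [hm, Nat.cast_pow]
  exact pow_ne_zero m hp

/-- The number of `u ∈ U` with `nun⁻¹ ∈ U` is a power of `p`. -/
theorem card_conj_mem_U_ne_zero (hp : (p : k) ≠ 0) (n : G) :
    (Nat.card {u : D.U // n * u * n⁻¹ ∈ D.U} : k) ≠ 0 := by
  let H : Subgroup D.U := (D.U.comap (MulAut.conj n).toMonoidHom).subgroupOf D.U
  have hU : IsPGroup p D.U := (pCore_isPGroup p D.B).map D.B.subtype
  obtain ⟨m, hm⟩ := IsPGroup.iff_card.1 (hU.to_subgroup H)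
  change (Nat.card H : k) ≠ 0
  rw [hm, Nat.cast_pow]
  exact pow_ne_zero m hp

variable {D ρ} in
/-- The weights of `ρ` are permuted by the simple reflections. -/
theorem HasWeight.reflection (hp : (p : k) ≠ 0) {n : D.N} (hn : (n : D.W) ∈ D.S) {χ : G → k}
    (h : D.HasWeight ρ χ) : D.HasWeight ρ fun t => χ (n * t * (n : G)⁻¹) := by
  classical
  let := Fintype.ofFinite D.U
  obtain ⟨y, hy, hU, hT⟩ := h
  have hz : ∀ t ∈ D.T, ρ t (ρ (n : G)⁻¹ y) = χ (n * t * (n : G)⁻¹) • ρ (n : G)⁻¹ y := by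
    intro t ht
    rw [← map_smul, ← hT _ (D.conj_mem_T n.2 ht)]
    simp only [← Module.End.mul_apply, ← map_mul]
    simp [mul_assoc]
  -- Averaging `n⁻¹ y` over `U` gives the new weight vector. If it vanished, applying `n` and
  -- averaging again would still return a nonzero multiple of `y`.
  refine ⟨D.sumU ρ (ρ (n : G)⁻¹ y), fun h0 => ?_, fun u hu => D.apply_sumU_of_mem ρ hu _,
    fun t ht => by rw [← D.sumU_comm ρ ht.1, hz t ht, map_smul]⟩
  have hterm : ∀ u : D.U, D.sumU ρ (ρ ((n : G) * u * (n : G)⁻¹) y) =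
      if (n : G) * u * (n : G)⁻¹ ∈ D.U then (Nat.card D.U : k) • y else 0 := by
    intro u
    split_ifs with hu
    · rw [D.sumU_apply_of_mem ρ hu, D.sumU_of_invariant ρ hU]
    · have hB : (n : G) * u * (n : G)⁻¹ ∉ D.B := fun h => hu (D.mem_U_of_conj u.2 h)
      -- With `m = n⁻¹` the exchange axiom leaves only `B` and `B n⁻¹ B`. The first is excluded; in
      -- the second the average is a translate of a multiple of the vector assumed to vanish.
      have := D.exchange n n⁻¹ hn u (D.U_le_B u.2)
      simp only [Set.mem_union, DoubleCoset.mem_doubleCoset] at this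
      rcases this with ⟨b, hb, c, hc, h⟩ | ⟨b, hb, c, hc, h⟩
      · refine absurd ?_ hB
        simp only [InvMemClass.coe_inv, mul_inv_cancel, mul_one] at h
        rw [h]
        exact mul_mem hb hc
      · simp only [InvMemClass.coe_inv] at h
        obtain ⟨v, hv, t, ht, rfl⟩ := D.exists_eq_mul hc
        rw [h, map_mul, map_mul, map_mul, Module.End.mul_apply, Module.End.mul_apply,
          Module.End.mul_apply, D.sumU_comm ρ hb, hT t ht, map_smul, hU v hv, map_smul, map_smul,
          h0, smul_zero, map_zero]
  have hsum : D.sumU ρ (ρ n (D.sumU ρ (ρ (n : G)⁻¹ y))) =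
      (Nat.card {u : D.U // (n : G) * u * (n : G)⁻¹ ∈ D.U} : k) • (Nat.card D.U : k) • y := by
    rw [D.sumU_apply ρ (ρ (n : G)⁻¹ y), map_sum, map_sum]
    simp only [← Module.End.mul_apply (ρ _), ← map_mul, ← mul_assoc]
    rw [Finset.sum_congr rfl fun u _ => hterm u, Finset.sum_ite]
    simp [Nat.card_eq_fintype_card, Fintype.card_subtype, ← Nat.cast_smul_eq_nsmul k]
  rw [h0, map_zero, map_zero] at hsum
  exact smul_ne_zero (D.card_conj_mem_U_ne_zero hp n) (smul_ne_zero (D.card_U_ne_zero hp) hy)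
    hsum.symm

variable {D ρ} in
/-- The weights of `ρ` are permuted by `N`. -/
theorem HasWeight.conj (hp : (p : k) ≠ 0) {n : G} (hn : n ∈ D.N) {χ : G → k}
    (h : D.HasWeight ρ χ) : D.HasWeight ρ fun t => χ (n * t * n⁻¹) := by
  refine D.N_induction (P := fun n => ∀ χ : G → k, D.HasWeight ρ χ →
    D.HasWeight ρ fun t => χ (n * t * n⁻¹)) ?_ ?_ ?_ hn χ h
  · intro t ht χ h
    refine h.congr fun s hs => ?_
    rw [D.comm t ht s hs, mul_inv_cancel_right]
  · exact fun n hn χ h => h.reflection hp hn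
  · intro a _ b _ ha hb χ h
    simpa [mul_assoc] using hb _ (ha χ h)

end Weights

end SplitBNPair

end HarishChandra

/-! ### Weights of subquotients and of induced modules -/

namespace HarishChandra

namespace SplitBNPair

section InducedWeights

variable {p : ℕ} {k : Type*} [Field k] {G : Type*} [Group G] (D : SplitBNPair p G)
  {M : Type*} [AddCommGroup M] [Module k M] (ρ : Representation k G M)

/-- The common eigenspace of `T` with eigenvalues `χ`. -/
def eigenspaceT (χ : G → k) : Submodule k M :=
  ⨅ t : D.T, LinearMap.ker (ρ t - χ t • 1)

theorem mem_eigenspaceT {χ : G → k} {m : M} :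
    m ∈ D.eigenspaceT ρ χ ↔ ∀ t ∈ D.T, ρ t m = χ t • m := by
  simp [eigenspaceT, sub_eq_zero]

/-- A vector in a sum of eigenspaces of `T` that becomes an eigenvector modulo an invariant subspace
has one of the given eigenvalues there. -/
theorem exists_eq_of_mem_iSup_eigenspaceT {ι : Type*} (s : Finset ι) (ψ : ι → G → k) {χ : G → k}
    {N : Submodule k M} (hN : ∀ g, ∀ m ∈ N, ρ g m ∈ N) {m : M}
    (hm : m ∈ ⨆ i ∈ s, D.eigenspaceT ρ (ψ i)) (hmN : m ∉ N)
    (hχ : ∀ t ∈ D.T, ρ t m - χ t • m ∈ N) : ∃ i ∈ s, ∀ t ∈ D.T, χ t = ψ i t := by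
  classical
  induction s using Finset.induction_on generalizing m with
  | empty =>
    simp only [Finset.notMem_empty, iSup_false, iSup_bot, Submodule.mem_bot] at hm
    exact absurd (hm ▸ N.zero_mem) hmN
  | insert i s hi ih =>
    by_cases h : ∀ t ∈ D.T, χ t = ψ i t
    · exact ⟨i, by simp, h⟩
    push Not at h
    obtain ⟨t, ht, hti⟩ := h
    have hm' : ρ t m - ψ i t • m = (ρ t m - χ t • m) + (χ t - ψ i t) • m := by module
    suffices ∃ j ∈ s, ∀ t ∈ D.T, χ t = ψ j t by
      obtain ⟨j, hj, h⟩ := this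
      exact ⟨j, by simp [hj], h⟩
    -- The operator `ρ t - ψ i t` kills the component of `m` for `i`, and modulo `N` it multiplies
    -- `m` by the nonzero scalar `χ t - ψ i t`.
    refine ih (m := ρ t m - ψ i t • m) ?_ ?_ ?_
    · rw [Finset.iSup_insert] at hm
      obtain ⟨a, ha, b, hb, rfl⟩ := Submodule.mem_sup.1 hm
      rw [mem_eigenspaceT] at ha
      have hb' : ρ t b ∈ ⨆ j ∈ s, D.eigenspaceT ρ (ψ j) := by
        have : ⨆ j ∈ s, D.eigenspaceT ρ (ψ j) ≤
            (⨆ j ∈ s, D.eigenspaceT ρ (ψ j)).comap (ρ t) := by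
          refine iSup₂_le fun j hj x hx => ?_
          rw [Submodule.mem_comap, (D.mem_eigenspaceT ρ).1 hx t ht]
          exact Submodule.smul_mem _ _ (Submodule.mem_iSup_of_mem j
            (Submodule.mem_iSup_of_mem hj hx))
        exact this hb
      have : ρ t (a + b) - ψ i t • (a + b) = ρ t b - ψ i t • b := by
        rw [map_add, ha t ht]
        module
      rw [this]
      exact sub_mem hb' (Submodule.smul_mem _ _ hb)
    · rw [hm']
      intro h
      rw [Submodule.add_mem_iff_right _ (hχ t ht), Submodule.smul_mem_iff _ (sub_ne_zero.2 hti)] at h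
      exact hmN h
    · intro t' ht'
      have : ρ t' (ρ t m - ψ i t • m) - χ t' • (ρ t m - ψ i t • m) =
          (ρ t' (ρ t m - χ t • m) - χ t' • (ρ t m - χ t • m)) +
            (χ t - ψ i t) • (ρ t' m - χ t' • m) := by
        simp only [map_sub, map_smul]
        module
      rw [this]
      exact add_mem (sub_mem (hN _ _ (hχ t ht)) (Submodule.smul_mem _ _ (hχ t ht)))
        (Submodule.smul_mem _ _ (hχ t' ht'))

variable [Finite G] [Fact p.Prime]

/-- If a weight occurs in a subquotient of `ρ`, it is one of the weights of the space `sumU ρ`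
of `U`-invariants of `ρ`. -/
theorem exists_eq_of_hasWeight_subquotient (hp : (p : k) ≠ 0) {ι : Type*} [Finite ι]
    (ψ : ι → G → k) (hρ : LinearMap.range (D.sumU ρ) ≤ ⨆ i, D.eigenspaceT ρ (ψ i))
    {V : Type*} [AddCommGroup V] [Module k V] {σ : Representation k G V}
    {N₁ N₂ : Submodule k[G] ρ.asModule}
    (e : (N₂ ⧸ N₁.comap N₂.subtype) ≃ₗ[k[G]] σ.asModule) {χ : G → k} (h : D.HasWeight σ χ) :
    ∃ i, ∀ t ∈ D.T, χ t = ψ i t := by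
  obtain ⟨v, hv, hU, hT⟩ := h
  let N : Submodule k M := N₁.restrictScalars k
  have hN : ∀ g, ∀ m ∈ N, ρ g m ∈ N := by
    intro g m hm
    have := N₁.smul_mem (MonoidAlgebra.of k G g) hm
    rwa [← ρ.asModuleEquiv.symm_apply_apply m, ← Representation.asModuleEquiv_symm_map_rho] at this
  obtain ⟨m, hm⟩ := Submodule.mkQ_surjective _ (e.symm (σ.asModuleEquiv.symm v))
  -- Eigenvector equations for `v` lift to a representative `m` modulo `N`; this serves for `U` with
  -- `c = 1` and for `T` with `c = χ t`.
  have hact : ∀ g (c : k), σ g v = c • v → ρ g (ρ.asModuleEquiv m) - c • ρ.asModuleEquiv m ∈ N := by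
    intro g c hg
    have h0 : MonoidAlgebra.of k G g • (σ.asModuleEquiv.symm v) -
        algebraMap k k[G] c • σ.asModuleEquiv.symm v = 0 := by
      rw [← Representation.asModuleEquiv_symm_map_rho,
        ← Representation.asModuleEquiv_symm_map_smul, hg, sub_self]
    have h1 := congr_arg e.symm h0
    rw [map_zero, map_sub, map_smul, map_smul, ← hm, ← map_smul, ← map_smul, ← map_sub] at h1
    have h2 : MonoidAlgebra.of k G g • (m : ρ.asModule) - algebraMap k k[G] c • (m : ρ.asModule)
        ∈ N₁ := by
      rwa [Submodule.mkQ_apply, Submodule.Quotient.mk_eq_zero] at h1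
    rwa [← ρ.asModuleEquiv.symm_apply_apply m, ← Representation.asModuleEquiv_symm_map_rho,
      ← Representation.asModuleEquiv_symm_map_smul] at h2
  have hmN : ρ.asModuleEquiv m ∉ N := by
    intro h
    have h1 : Submodule.mkQ (N₁.comap N₂.subtype) m = 0 := by
      rw [Submodule.mkQ_apply, Submodule.Quotient.mk_eq_zero]
      exact h
    rw [hm] at h1
    exact hv (by simpa using h1)
  -- The sum over `U` replaces `m` by a genuine `U`-invariant, congruent to `|U|` times `m` and so
  -- still outside `N`.
  have hsum : D.sumU ρ (ρ.asModuleEquiv m) - (Nat.card D.U : k) • ρ.asModuleEquiv m ∈ N := by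
    let := Fintype.ofFinite D.U
    have : D.sumU ρ (ρ.asModuleEquiv m) - (Nat.card D.U : k) • ρ.asModuleEquiv m =
        ∑ u : D.U, (ρ u (ρ.asModuleEquiv m) - (1 : k) • ρ.asModuleEquiv m) := by
      rw [sumU_apply, Finset.sum_sub_distrib]
      simp [Nat.card_eq_fintype_card, Nat.cast_smul_eq_nsmul]
    rw [this]
    exact Submodule.sum_mem _ fun u _ => hact u 1 (by rw [hU u u.2, one_smul])
  have := Fintype.ofFinite ι
  have hsumN : D.sumU ρ (ρ.asModuleEquiv m) ∉ N := by
    intro h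
    have := sub_mem h hsum
    rw [sub_sub_cancel, Submodule.smul_mem_iff _ (D.card_U_ne_zero hp)] at this
    exact hmN this
  have hsumT : ∀ t ∈ D.T,
      ρ t (D.sumU ρ (ρ.asModuleEquiv m)) - χ t • D.sumU ρ (ρ.asModuleEquiv m) ∈ N := by
    intro t ht
    have : ρ t (D.sumU ρ (ρ.asModuleEquiv m)) - χ t • D.sumU ρ (ρ.asModuleEquiv m) =
        ρ t (D.sumU ρ (ρ.asModuleEquiv m) - (Nat.card D.U : k) • ρ.asModuleEquiv m) -
          χ t • (D.sumU ρ (ρ.asModuleEquiv m) - (Nat.card D.U : k) • ρ.asModuleEquiv m) +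
          (Nat.card D.U : k) • (ρ t (ρ.asModuleEquiv m) - χ t • ρ.asModuleEquiv m) := by
      simp only [map_sub, map_smul]
      module
    rw [this]
    exact add_mem (sub_mem (hN _ _ hsum) (Submodule.smul_mem _ _ hsum))
      (Submodule.smul_mem _ _ (hact t _ (hT t ht)))
  obtain ⟨i, -, hi⟩ := D.exists_eq_of_mem_iSup_eigenspaceT ρ Finset.univ ψ hN
    (by simpa using hρ ⟨_, rfl⟩) hsumN hsumT
  exact ⟨i, hi⟩

/-- The weights of `R_T^G(X)` are the `N`-conjugates of the character of `X`. -/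
theorem range_sumU_hcInd_le {X : Type*} [AddCommGroup X] [Module k X] (τ : Representation k D.T X)
    {χ : G → k} (hχ : ∀ t (ht : t ∈ D.T) x, τ ⟨t, ht⟩ x = χ t • x) :
    LinearMap.range (D.sumU (hcInd D.isLeviComplement τ)) ≤
      ⨆ n : D.N, D.eigenspaceT (hcInd D.isLeviComplement τ) fun t => χ (n * t * (n : G)⁻¹) := by
  let σ := τ.comp (leviProj D.isLeviComplement)
  let ρ := hcInd D.isLeviComplement τ
  let E := ⨆ n : D.N, D.eigenspaceT ρ fun t => χ (n * t * (n : G)⁻¹)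
  have hact : ∀ g h x, ρ g (Representation.IndV.mk D.B.subtype σ h x) =
    Representation.IndV.mk D.B.subtype σ (h * g⁻¹) x := Representation.ind_mk _ _
  have hmk : ∀ b (hb : b ∈ D.B) g x, Representation.IndV.mk D.B.subtype σ (b * g) x =
      Representation.IndV.mk D.B.subtype σ g (σ ⟨b, hb⟩⁻¹ x) := by
    intro b hb g x
    simp
  have hgen : ∀ g x, D.sumU ρ (Representation.IndV.mk D.B.subtype σ g x) ∈ E := by
    intro g x
    obtain ⟨b, hb, n, hn, b', hb', rfl⟩ := D.bruhat g
    have hstep : ∀ y, D.sumU ρ (Representation.IndV.mk D.B.subtype σ n y) ∈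
        D.eigenspaceT ρ fun t => χ (n * t * n⁻¹) := by
      refine fun y => (D.mem_eigenspaceT ρ).2 fun t ht => ?_
      have hT := D.conj_mem_T hn ht
      have : n * t⁻¹ = (n * t * n⁻¹)⁻¹ * n := by group
      rw [← D.sumU_comm ρ ht.1, hact, this, hmk _ (inv_mem hT.1), ← map_smul]
      congr 2
      have h1 : (⟨(n * t * n⁻¹)⁻¹, inv_mem hT.1⟩ : D.B)⁻¹ = ⟨n * t * n⁻¹, hT.1⟩ := by
        ext; simp
      rw [h1]
      simp only [σ, MonoidHom.comp_apply]
      rw [D.leviProj_of_mem_T ⟨_, hT.1⟩ hT, hχ, map_smul]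
    -- In `g = b n b'` the factor `b` is absorbed into `X`, and `b'⁻¹ = u t` acts on the generator
    -- at `n`; the sum over `U` absorbs `u`, and `t` contributes a scalar.
    obtain ⟨u, hu, t, ht, hb''⟩ := D.exists_eq_mul (inv_mem hb')
    have h1 : Representation.IndV.mk D.B.subtype σ (b * n * b') x =
        ρ (u * t) (Representation.IndV.mk D.B.subtype σ n (σ ⟨b, hb⟩⁻¹ x)) := by
      rw [hact, ← hmk, ← hb'', inv_inv, mul_assoc]
    rw [h1, map_mul, Module.End.mul_apply, D.sumU_apply_of_mem ρ hu, D.sumU_comm ρ ht.1,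
      (D.mem_eigenspaceT ρ).1 (hstep _) t ht]
    exact Submodule.smul_mem _ _ (Submodule.mem_iSup_of_mem ⟨n, hn⟩ (hstep _))
  have h0 : E.mkQ ∘ₗ D.sumU ρ = 0 := Representation.IndV.hom_ext _ _ fun g => by
    ext x
    simpa using hgen g x
  rintro _ ⟨m, rfl⟩
  simpa using LinearMap.congr_fun h0 m

end InducedWeights

end SplitBNPair

end HarishChandra

/-! ### Principal series in terms of weights -/

namespace HarishChandra

namespace SplitBNPair

variable {p : ℕ} {k : Type*} [Field k] {G : Type*} [Group G] [Finite G]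
  (D : SplitBNPair p G)

theorem exists_character {X : Type*} [AddCommGroup X] [Module k X] [IsAlgClosed k]
    {τ : Representation k D.T X} (hτ : τ.IsIrreducible) :
    ∃ χ : G → k, (∀ t (ht : t ∈ D.T) x, τ ⟨t, ht⟩ x = χ t • x) ∧ Module.finrank k X = 1 := by
  classical
  have := D.isMulCommutative_T
  obtain ⟨χ, hχ, hX⟩ := HarishChandra.exists_character hτ
  -- The value `0` off `T` is arbitrary: characters are only ever evaluated on `T`.
  exact ⟨fun g => if h : g ∈ D.T then χ ⟨g, h⟩ else 0, fun t ht x => by simp [hχ, ht], hX⟩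

variable [Fact p.Prime]

/-- An irreducible `kT`-module is a composition factor of `*R_T^G(Y)` if and only if its character
is a weight of `Y`. -/
theorem compositionMultiplicity_hcRes_ne_zero_iff {X : Type*} [AddCommGroup X] [Module k X]
    {τ : Representation k D.T X} (hτ : τ.IsIrreducible) {χ : G → k}
    (hχ : ∀ t (ht : t ∈ D.T) x, τ ⟨t, ht⟩ x = χ t • x) (hX : Module.finrank k X = 1)
    {Y : Type*} [AddCommGroup Y] [Module k Y] [FiniteDimensional k Y]
    (ρ : Representation k G Y) :
    compositionMultiplicity (hcRes D.isLeviComplement ρ) τ ≠ 0 ↔ D.HasWeight ρ χ := by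
  have := D.isMulCommutative_T
  rw [compositionMultiplicity_ne_zero_iff_exists_eigenvector (χ := fun t : D.T => χ t) _ hτ
    (fun t => hχ t t.2) hX]
  constructor
  · rintro ⟨y, hy, h⟩
    refine ⟨y, fun h0 => hy (Subtype.ext h0), ?_, fun t ht => congr_arg Subtype.val (h ⟨t, ht⟩)⟩
    rintro _ ⟨u, hu, rfl⟩
    exact y.2 ⟨u, hu⟩
  · rintro ⟨y, hy, hU, hT⟩
    refine ⟨⟨y, fun u => hU _ ⟨u, u.2, rfl⟩⟩, fun h0 => hy (congr_arg Subtype.val h0),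
      fun t => Subtype.ext (hT t t.2)⟩

/-- The remaining conditions defining the series, nonvanishing and minimality of `T`, do not involve
`X`. -/
theorem principalSeries_subset {X X' : Type*} [AddCommGroup X] [Module k X]
    [AddCommGroup X'] [Module k X'] {τ : Representation k D.T X} {τ' : Representation k D.T X'}
    (h : ∀ Y : Rep.{w} k G, Y.ρ.IsIrreducible →
      compositionMultiplicity (hcRes D.isLeviComplement Y.ρ) τ ≠ 0 →
      compositionMultiplicity (hcRes D.isLeviComplement Y.ρ) τ' ≠ 0) :
    (principalSeries D τ : Set (Rep.{w} k G)) ⊆ principalSeries D τ' :=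
  fun Y hY => ⟨hY.1, hY.2.1, hY.2.2.1, h Y hY.1 hY.2.2.2⟩

end SplitBNPair

end HarishChandra

theorem proposition4p2
    {p r : ℕ} [Fact p.Prime] (hr : 0 < r) (hrp : r ≠ p)
    {k : Type u} [Field k] [IsAlgClosed k] [CharP k r]
    {G : Type v} [Group G] [Finite G] (D : HarishChandra.SplitBNPair p G)
    {X X' : Type*} [AddCommGroup X] [Module k X] [AddCommGroup X'] [Module k X']
    (τ : Representation k D.T X) (τ' : Representation k D.T X')
    (hτ : τ.IsIrreducible) (hτ' : τ'.IsIrreducible)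
    (Y V : Rep.{w} k G)
    (hY : Y ∈ HarishChandra.principalSeries D τ)
    (hV : V ∈ HarishChandra.principalSeries D τ')
    (hne : (HarishChandra.principalSeries D τ : Set (Rep.{w} k G)) ≠
      HarishChandra.principalSeries D τ') :
    HarishChandra.compositionMultiplicity
      (HarishChandra.hcInd D.isLeviComplement τ) V.ρ = 0 := by
  by_contra hmult
  have hp : (p : k) ≠ 0 := by
    rw [ne_eq, CharP.cast_eq_zero_iff k r]
    intro h
    rcases (Nat.dvd_prime Fact.out).1 h with h | h
    · exact CharP.char_ne_one k r h
    · exact hrp h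
  obtain ⟨χ, hχ, hX⟩ := D.exists_character hτ
  obtain ⟨χ', hχ', hX'⟩ := D.exists_character hτ'
  have hVfin := hV.1.finiteDimensional
  have hweight : D.HasWeight V.ρ χ' :=
    (D.compositionMultiplicity_hcRes_ne_zero_iff hτ' hχ' hX' V.ρ).1 hV.2.2.2
  obtain ⟨s, -, -, i, ⟨e⟩⟩ := (HarishChandra.compositionMultiplicity_ne_zero_iff _ _).1 hmult
  -- On `T`, `χ'` is `χ` conjugated by `n`; conjugating weights by `n` and by `n⁻¹` gives the two
  -- inclusions.
  obtain ⟨⟨n, hn⟩, h⟩ := D.exists_eq_of_hasWeight_subquotient _ hp _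
    (D.range_sumU_hcInd_le τ hχ) e hweight
  refine hne (Set.Subset.antisymm (D.principalSeries_subset fun Z hZ hmZ => ?_)
    (D.principalSeries_subset fun Z hZ hmZ => ?_))
  · have := hZ.finiteDimensional
    rw [D.compositionMultiplicity_hcRes_ne_zero_iff hτ hχ hX] at hmZ
    rw [D.compositionMultiplicity_hcRes_ne_zero_iff hτ' hχ' hX']
    exact (hmZ.conj hp hn).congr fun t ht => (h t ht).symm
  · have := hZ.finiteDimensional
    rw [D.compositionMultiplicity_hcRes_ne_zero_iff hτ' hχ' hX'] at hmZ
    rw [D.compositionMultiplicity_hcRes_ne_zero_iff hτ hχ hX]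
    refine (hmZ.conj hp (inv_mem hn)).congr fun t ht => ?_
    rw [h _ (D.conj_mem_T (inv_mem hn) ht)]
    congr 1
    group
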